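/- Let $\mathbf{Rel}$ be the dagger compact category of (small) sets and relations: composition of relations, tensor $\times$, dagger the converse relation, $A^*=A$, unit $\eta_A\colon I\to A^*\otimes A$ and counit $\varepsilon_A\colon A\otimes A^*\to I$ given by the diagonal. $\mathrm{CPM}[\mathbf{Rel}]$ has sets as objects; a morphism $A\to B$ is a completely positive morphism $f\colon A^*\otimes A\to B^*\otimes B$ of $\mathbf{Rel}$, i.e. one of the form $f=(\mathrm{id}_{B^*}\otimes\eta_C^\dagger\otimes \mathrm{id}_B)\circ(g_*\otimes g)$ for some set $C$ and some $g\colon A\to C\otimes B$, where $g_*\colon A^*\to B^*\otimes C^*$ is the dual of $g^\dagger$. It is enriched in commutative monoids by union of relations. $\mathrm{CPM}[\mathbf{Rel}]^\oplus$ is its biproduct completion: objects are finite families of objects, morphisms are matrices of morphisms, composed by matrix multiplication. $\mathrm{CP}^*[\mathbf{Rel}]$ has as objects the normalisable dagger Frobenius algebras in $\mathbf{Rel}$: sets $A$ with $m\colon A\otimes A\to A$ and $u\colon I\to A$ that are associative, unital and satisfy the Frobenius law $(m\otimes \mathrm{id})(\mathrm{id}\otimes m^\dagger)=m^\dagger m=(\mathrm{id}\otimes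 m)(m^\dagger\otimes \mathrm{id})$, together with a central positive isomorphism $n\colon A\to A$ such that $\eta_A^\dagger\circ a_A\circ n\circ n=u^\dagger$, where $a_A=(\mathrm{id}_{A^*}\otimes m)\circ(\eta_A\otimes \mathrm{id}_A)\colon A\to A^*\otimes A$. A morphism $A\to B$ is a relation $f\colon A\to B$ such that $a_B\circ f\circ a_A^\dagger$ is completely positive. Every small groupoid $G$ gives an object of $\mathrm{CP}^*[\mathbf{Rel}]$, namely its set of morphisms, with $m$ the composition of composable morphisms, $u$ the set of identities and $n=\mathrm{id}$. Let $L\colon \mathrm{CPM}[\mathbf{Rel}]^\oplus\to \mathrm{CP}^*[\mathbf{Rel}]$ be the canonical functor, which sends $(A_i)_i$ to the direct sum (disjoint union with blockwise $m$ and $u$) of the algebras $(A_i^*\otimes A_i,\ \mathrm{id}\otimes\varepsilon_{A_i}\otimes \mathrm{id},\ \eta_{A_i})$ and a matrix $(f_{ij})$ to the corresponding relation between the disjoint unions. Then: 1. $L$ is not an equivalence of categories. 2. There is no equivalence of categories between $\mathrm{CPM}[\mathbf{Rel}]^\oplus$ and $\mathrm{CP}^*[\mathbf{Rel}]$. 3.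 If a small groupoid $H$ is isomorphic in $\mathrm{CP}^*[\mathbf{Rel}]$ to the group $\mathbb{Z}_2$, viewed as a groupoid with one object, then $H$ has exactly one object and exactly two morphisms. 4. $\mathbb{Z}_2$, viewed as a groupoid with one object, is not isomorphic in $\mathrm{CP}^*[\mathbf{Rel}]$ to a disjoint union of a (small) family of indiscrete groupoids, where an indiscrete groupoid is one with exactly one morphism between any two objects. -/

import Mathlib

open CategoryTheory MonoidalCategory

universe v u

namespace CQM

/-- A dagger category. -/
class DaggerCategory (V : Type u) [Category.{v} V] where
  dagger {X Y : V} (f : X ⟶ Y) : Y ⟶ X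
  dagger_id (X : V) : dagger (𝟙 X) = 𝟙 X
  dagger_comp {X Y Z : V} (f : X ⟶ Y) (g : Y ⟶ Z) : dagger (f ≫ g) = dagger g ≫ dagger f
  dagger_dagger {X Y : V} (f : X ⟶ Y) : dagger (dagger f) = f

postfix:max "†" => DaggerCategory.dagger

/-- A dagger compact category. The dual `A*` is the left dual `ᘁA`, with unit
`η : I ⟶ A* ⊗ A` and counit `ε : A ⊗ A* ⟶ I`. -/
class DaggerCompactCategory (V : Type u) [Category.{v} V] [MonoidalCategory V]
    [SymmetricCategory V] extends DaggerCategory V, LeftRigidCategory V where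
  dagger_tensor {X Y X' Y' : V} (f : X ⟶ Y) (g : X' ⟶ Y') : (f ⊗ₘ g)† = f† ⊗ₘ g†
  dagger_associator (X Y Z : V) : (α_ X Y Z).hom† = (α_ X Y Z).inv
  dagger_leftUnitor (X : V) : (λ_ X).hom† = (λ_ X).inv
  dagger_rightUnitor (X : V) : (ρ_ X).hom† = (ρ_ X).inv
  dagger_braiding (X Y : V) : (β_ X Y).hom† = (β_ X Y).inv
  evaluation_eq (X : V) : ε_ (ᘁX : V) X = (β_ X (ᘁX : V)).hom ≫ (η_ (ᘁX : V) X)†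

section General

variable {V : Type u} [Category.{v} V] [MonoidalCategory V] [SymmetricCategory V]
  [DaggerCompactCategory V]

/-- The cap `A* ⊗ A ⟶ I`, i.e. the dagger of the unit of the duality. -/
def cap (A : V) : (ᘁA : V) ⊗ A ⟶ 𝟙_ V := (η_ (ᘁA : V) A)†

/-- The conjugate `g_* : A* ⟶ B* ⊗ C*` of a morphism `g : A ⟶ C ⊗ B`: the dual of `g†`, where
`(C ⊗ B)*` is identified with `B* ⊗ C*`. -/
def conj {A B C : V} (g : A ⟶ C ⊗ B) : (ᘁA : V) ⟶ (ᘁB : V) ⊗ (ᘁC : V) :=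
  (λ_ _).inv ≫ (η_ (ᘁB : V) B ▷ _) ≫
    (((ᘁB : V) ◁ ((λ_ B).inv ≫ (η_ (ᘁC : V) C ▷ B) ≫ (α_ _ _ _).hom)) ▷ _) ≫
    ((α_ _ _ _).inv ▷ _) ≫ (α_ _ _ _).hom ≫
    (_ ◁ ((g† ▷ _) ≫ ε_ (ᘁA : V) A)) ≫ (ρ_ _).hom

/-- Complete positivity of `f : A* ⊗ A ⟶ B* ⊗ B`: there is `g : A ⟶ C ⊗ B` such that `f` is
`g_* ⊗ g` followed by the cap joining `C*` and `C`. -/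
def IsCP {A B : V} (f : (ᘁA : V) ⊗ A ⟶ (ᘁB : V) ⊗ B) : Prop :=
  ∃ (C : V) (g : A ⟶ C ⊗ B),
    f = (conj g ⊗ₘ g) ≫ (α_ _ _ _).hom ≫ (_ ◁ (α_ _ _ _).inv) ≫
      (_ ◁ (cap C ▷ B)) ≫ (_ ◁ (λ_ B).hom)

variable (V) in
/-- Objects of `CPM[V]`: the objects of `V`. -/
structure CPM where
  of : V

/-- Morphisms of `CPM[V]`. -/
@[ext]
structure CPM.Hom (A B : CPM V) where
  hom : (ᘁA.of : V) ⊗ A.of ⟶ (ᘁB.of : V) ⊗ B.of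
  cp : IsCP hom

variable (V) in
/-- Dagger Frobenius algebras in `V`. -/
structure DaggerFrobenius where
  carrier : V
  mul : carrier ⊗ carrier ⟶ carrier
  unit : 𝟙_ V ⟶ carrier
  mul_assoc : (mul ▷ carrier) ≫ mul = (α_ _ _ _).hom ≫ (carrier ◁ mul) ≫ mul
  unit_mul : (unit ▷ carrier) ≫ mul = (λ_ carrier).hom
  mul_unit : (carrier ◁ unit) ≫ mul = (ρ_ carrier).hom
  frobenius_left : (carrier ◁ mul†) ≫ (α_ _ _ _).inv ≫ (mul ▷ carrier) = mul ≫ mul†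
  frobenius_right : (mul† ▷ carrier) ≫ (α_ _ _ _).hom ≫ (carrier ◁ mul) = mul ≫ mul†

namespace DaggerFrobenius

/-- The action map `A ⟶ A* ⊗ A`, the transpose of the multiplication in its first argument. -/
def action (A : DaggerFrobenius V) : A.carrier ⟶ (ᘁA.carrier : V) ⊗ A.carrier :=
  (λ_ _).inv ≫ (η_ (ᘁA.carrier : V) A.carrier ▷ _) ≫ (α_ _ _ _).hom ≫ (_ ◁ A.mul)

/-- The coaction map `A* ⊗ A ⟶ A`. -/
def coaction (A : DaggerFrobenius V) : (ᘁA.carrier : V) ⊗ A.carrier ⟶ A.carrier := A.action†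

/-- `z : A ⟶ A` is central for the multiplication. -/
def IsCentral (A : DaggerFrobenius V) (z : A.carrier ⟶ A.carrier) : Prop :=
  (z ▷ A.carrier) ≫ A.mul = A.mul ≫ z ∧ (A.carrier ◁ z) ≫ A.mul = A.mul ≫ z

end DaggerFrobenius

/-- `g : A ⟶ A` is positive when `g = h† ∘ h` for some `h`. -/
def IsPositive {A : V} (g : A ⟶ A) : Prop := ∃ (B : V) (h : A ⟶ B), g = h ≫ h†

variable (V) in
/-- Objects of `CP*[V]`: normalisable dagger Frobenius algebras, i.e. dagger Frobenius algebras
with a central positive isomorphism `norm` such that tracing out the action precomposed with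
`norm ∘ norm` gives the counit. -/
structure CPStar extends DaggerFrobenius V where
  norm : carrier ≅ carrier
  norm_central : toDaggerFrobenius.IsCentral norm.hom
  norm_positive : IsPositive norm.hom
  normalisable : norm.hom ≫ norm.hom ≫ toDaggerFrobenius.action ≫ cap carrier = unit†

/-- Morphisms of `CP*[V]`: morphisms `f` of `V` such that `action ∘ f ∘ coaction` is completely
positive. -/
@[ext]
structure CPStar.Hom (A B : CPStar V) where
  hom : A.carrier ⟶ B.carrier
  cp : IsCP (A.coaction ≫ hom ≫ B.action)

end General

/-! ### The dagger compact category of relations -/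

section Rel

/-- The underlying set of an object of `RelCat`. -/
def El (X : RelCat.{u}) : Type u := X

/-- A set as an object of `RelCat`. -/
def relOf (X : Type u) : RelCat.{u} := X

/-- Morphisms of `RelCat` from predicates. -/
def rel {X Y : RelCat.{u}} (r : El X → El Y → Prop) : X ⟶ Y :=
  RelCat.Hom.ofRel {p : El X × El Y | r p.1 p.2}

/-- `x` is related to `y` by `f`. -/
def Holds {X Y : RelCat.{u}} (f : X ⟶ Y) (x : El X) (y : El Y) : Prop :=
  (x, y) ∈ RelCat.Hom.rel f

theorem rel_ext {X Y : RelCat.{u}} {f g : X ⟶ Y} (h : ∀ x y, Holds f x y ↔ Holds g x y) :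
    f = g := by
  apply RelCat.Hom.ext
  ext ⟨x, y⟩
  exact h x y

@[simp] theorem holds_rel {X Y : RelCat.{u}} (r : El X → El Y → Prop) (x : El X) (y : El Y) :
    Holds (rel r) x y ↔ r x y := Iff.rfl

@[simp] theorem holds_id {X : RelCat.{u}} (x y : El X) : Holds (𝟙 X) x y ↔ x = y := Iff.rfl

@[simp] theorem holds_comp {X Y Z : RelCat.{u}} (f : X ⟶ Y) (g : Y ⟶ Z) (x : El X) (z : El Z) :
    Holds (f ≫ g) x z ↔ ∃ y, Holds f x y ∧ Holds g y z := Iff.rfl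

/-- The isomorphism of `RelCat` given by a bijection. -/
def relIso {X Y : RelCat.{u}} (e : El X ≃ El Y) : X ≅ Y where
  hom := rel fun x y => e x = y
  inv := rel fun y x => e x = y
  hom_inv_id := rel_ext (by simp [eq_comm])
  inv_hom_id := rel_ext fun x y => by
    simp only [holds_comp, holds_rel, holds_id]
    constructor
    · rintro ⟨z, rfl, rfl⟩; rfl
    · rintro rfl; exact ⟨e.symm x, by simp, by simp⟩

@[simp] theorem holds_relIso_hom {X Y : RelCat.{u}} (e : El X ≃ El Y) (x : El X) (y : El Y) :
    Holds (relIso e).hom x y ↔ e x = y := Iff.rfl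

@[simp] theorem holds_relIso_inv {X Y : RelCat.{u}} (e : El X ≃ El Y) (x : El X) (y : El Y) :
    Holds (relIso e).inv y x ↔ e x = y := Iff.rfl

/-- The monoidal structure of `RelCat` is the Cartesian product of sets. -/
instance : MonoidalCategoryStruct RelCat.{u} where
  tensorObj X Y := relOf (El X × El Y)
  tensorUnit := relOf PUnit
  tensorHom f g := rel fun (p : _ × _) (q : _ × _) => Holds f p.1 q.1 ∧ Holds g p.2 q.2
  whiskerLeft _ _ _ g := rel fun (p : _ × _) (q : _ × _) => p.1 = q.1 ∧ Holds g p.2 q.2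
  whiskerRight f _ := rel fun (p : _ × _) (q : _ × _) => Holds f p.1 q.1 ∧ p.2 = q.2
  associator X Y Z := relIso (Equiv.prodAssoc (El X) (El Y) (El Z))
  leftUnitor X := relIso (Equiv.punitProd (El X))
  rightUnitor X := relIso (Equiv.prodPUnit (El X))

/-- Pairs as elements of the tensor product. -/
def pr {X Y : RelCat.{u}} (x : El X) (y : El Y) : El (X ⊗ Y) := (x, y)

/-- The element of the tensor unit. -/
def st : El (𝟙_ RelCat.{u}) := PUnit.unit

section
variable {X Y Z X' Y' : RelCat.{u}}

@[simp] theorem pr_inj (x x' : El X) (y y' : El Y) : pr x y = pr x' y' ↔ x = x' ∧ y = y' :=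
  Prod.mk_inj
@[simp] theorem ex_pr (P : El (X ⊗ Y) → Prop) : (∃ p, P p) ↔ ∃ x y, P (pr x y) := Prod.exists
@[simp] theorem all_pr (P : El (X ⊗ Y) → Prop) : (∀ p, P p) ↔ ∀ x y, P (pr x y) := Prod.forall
@[simp] theorem ex_st (P : El (𝟙_ RelCat.{u}) → Prop) : (∃ p, P p) ↔ P st :=
  ⟨fun ⟨_, h⟩ => h, fun h => ⟨_, h⟩⟩
@[simp] theorem all_st (P : El (𝟙_ RelCat.{u}) → Prop) : (∀ p, P p) ↔ P st :=
  ⟨fun h => h _, fun h _ => h⟩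

@[simp] theorem holds_tensor (f : X ⟶ Y) (g : X' ⟶ Y') (x : El X) (x' : El X') (y : El Y)
    (y' : El Y') : Holds (f ⊗ₘ g) (pr x x') (pr y y') ↔ Holds f x y ∧ Holds g x' y' := Iff.rfl
@[simp] theorem holds_whiskerLeft (g : X' ⟶ Y') (x : El X) (x' : El X') (y : El X)
    (y' : El Y') : Holds (X ◁ g) (pr x x') (pr y y') ↔ x = y ∧ Holds g x' y' := Iff.rfl
@[simp] theorem holds_whiskerRight (f : X ⟶ Y) (x : El X) (x' : El X') (y : El Y)
    (y' : El X') : Holds (f ▷ X') (pr x x') (pr y y') ↔ Holds f x y ∧ x' = y' := Iff.rfl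
@[simp] theorem holds_assoc (x x' : El X) (y y' : El Y) (z z' : El Z) :
    Holds (α_ X Y Z).hom (pr (pr x y) z) (pr x' (pr y' z')) ↔ x = x' ∧ y = y' ∧ z = z' := by
  change (x, (y, z)) = (x', (y', z')) ↔ _
  simp only [Prod.mk_inj]
@[simp] theorem holds_assoc_inv (x x' : El X) (y y' : El Y) (z z' : El Z) :
    Holds (α_ X Y Z).inv (pr x' (pr y' z')) (pr (pr x y) z) ↔ x = x' ∧ y = y' ∧ z = z' :=
  holds_assoc x x' y y' z z'
@[simp] theorem holds_lu (s : El (𝟙_ RelCat.{u})) (x y : El X) :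
    Holds (λ_ X).hom (pr s x) y ↔ x = y := Iff.rfl
@[simp] theorem holds_lu_inv (s : El (𝟙_ RelCat.{u})) (x y : El X) :
    Holds (λ_ X).inv y (pr s x) ↔ x = y := Iff.rfl
@[simp] theorem holds_ru (s : El (𝟙_ RelCat.{u})) (x y : El X) :
    Holds (ρ_ X).hom (pr x s) y ↔ x = y := Iff.rfl
@[simp] theorem holds_ru_inv (s : El (𝟙_ RelCat.{u})) (x y : El X) :
    Holds (ρ_ X).inv y (pr x s) ↔ x = y := Iff.rfl
end

instance : MonoidalCategory RelCat.{u} where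
  tensorHom_def _ _ := rel_ext (by simp)
  id_tensorHom_id _ _ := rel_ext (by simp)
  tensorHom_comp_tensorHom _ _ _ _ := rel_ext (by simp; grind)
  whiskerLeft_id _ _ := rel_ext (by simp)
  id_whiskerRight _ _ := rel_ext (by simp)
  associator_naturality _ _ _ := rel_ext (by simp [and_assoc])
  leftUnitor_naturality _ := rel_ext (by simp)
  rightUnitor_naturality _ := rel_ext (by simp)
  pentagon _ _ _ _ := rel_ext (by simp [and_assoc])
  triangle _ _ := rel_ext (by simp)

/-- The symmetry of `RelCat` swaps the factors. -/
def relSwap (X Y : RelCat.{u}) : X ⊗ Y ≅ Y ⊗ X := relIso (Equiv.prodComm (El X) (El Y))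

@[simp] theorem holds_relSwap {X Y : RelCat.{u}} (x x' : El X) (y y' : El Y) :
    Holds (relSwap X Y).hom (pr x y) (pr y' x') ↔ y = y' ∧ x = x' := by
  change (y, x) = (y', x') ↔ _
  simp only [Prod.mk_inj]

@[simp] theorem holds_relSwap_inv {X Y : RelCat.{u}} (x x' : El X) (y y' : El Y) :
    Holds (relSwap X Y).inv (pr y' x') (pr x y) ↔ y = y' ∧ x = x' :=
  holds_relSwap x x' y y'

instance : BraidedCategory RelCat.{u} where
  braiding := relSwap
  braiding_naturality_right _ _ _ _ := rel_ext (by simp)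
  braiding_naturality_left _ _ := rel_ext (by simp [and_comm])
  hexagon_forward _ _ _ := rel_ext (by simp; grind)
  hexagon_reverse _ _ _ := rel_ext (by simp; grind)

@[simp] theorem braiding_eq (X Y : RelCat.{u}) : β_ X Y = relSwap X Y := rfl

instance : SymmetricCategory RelCat.{u} where
  symmetry _ _ := rel_ext (by simp; grind)

/-- The relation from the point to the diagonal. -/
def diag (X : RelCat.{u}) : 𝟙_ RelCat.{u} ⟶ X ⊗ X :=
  rel fun _ (p : El X × El X) => p.1 = p.2

/-- The relation from the diagonal to the point. -/
def codiag (X : RelCat.{u}) : X ⊗ X ⟶ 𝟙_ RelCat.{u} :=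
  rel fun (p : El X × El X) _ => p.1 = p.2

@[simp] theorem holds_diag {X : RelCat.{u}} (s : El (𝟙_ RelCat.{u})) (x y : El X) :
    Holds (diag X) s (pr x y) ↔ x = y := Iff.rfl
@[simp] theorem holds_codiag {X : RelCat.{u}} (s : El (𝟙_ RelCat.{u})) (x y : El X) :
    Holds (codiag X) (pr x y) s ↔ x = y := Iff.rfl

/-- Every set is its own dual. -/
instance : LeftRigidCategory RelCat.{u} where
  leftDual X :=
    { leftDual := X
      exact :=
        { coevaluation' := diag X
          evaluation' := codiag X
          coevaluation_evaluation' := rel_ext (by simp)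
          evaluation_coevaluation' := rel_ext (by simp) } }

/-- Elements of the dual `A*` of a set `A` are the elements of `A`. -/
def cj {X : RelCat.{u}} (x : El X) : El (ᘁX : RelCat.{u}) := x

section
variable {X Y : RelCat.{u}}
@[simp] theorem cj_inj (x y : El X) : cj x = cj y ↔ x = y := Iff.rfl
@[simp] theorem ex_cj (P : El (ᘁX : RelCat.{u}) → Prop) : (∃ p, P p) ↔ ∃ x, P (cj x) := Iff.rfl
@[simp] theorem all_cj (P : El (ᘁX : RelCat.{u}) → Prop) : (∀ p, P p) ↔ ∀ x, P (cj x) := Iff.rfl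
@[simp] theorem holds_eta (s : El (𝟙_ RelCat.{u})) (x y : El X) :
    Holds (η_ (ᘁX : RelCat.{u}) X) s (pr (cj x) y) ↔ x = y := Iff.rfl
@[simp] theorem holds_eps (s : El (𝟙_ RelCat.{u})) (x y : El X) :
    Holds (ε_ (ᘁX : RelCat.{u}) X) (pr x (cj y)) s ↔ x = y := Iff.rfl
end

/-- The dagger of a relation is its converse. -/
instance : DaggerCategory RelCat.{u} where
  dagger f := rel fun y x => Holds f x y
  dagger_id _ := rel_ext (by simp [eq_comm])
  dagger_comp _ _ := rel_ext (by simp [and_comm])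
  dagger_dagger _ := rel_ext (by simp)

@[simp] theorem holds_dagger {X Y : RelCat.{u}} (f : X ⟶ Y) (y : El Y) (x : El X) :
    Holds f† y x ↔ Holds f x y := Iff.rfl

instance : DaggerCompactCategory RelCat.{u} where
  dagger_tensor _ _ := rel_ext (by simp)
  dagger_associator _ _ _ := rel_ext (by simp)
  dagger_leftUnitor _ := rel_ext (by simp)
  dagger_rightUnitor _ := rel_ext (by simp)
  dagger_braiding _ _ := rel_ext (by simp)
  evaluation_eq _ := rel_ext (by simp [eq_comm])

@[simp] theorem holds_dagger' {X Y : RelCat.{u}} (f : X ⟶ Y) (y : El Y) (x : El X) :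
    Holds (DaggerCompactCategory.toDaggerCategory.dagger f) y x ↔ Holds f x y := Iff.rfl

@[simp] theorem holds_cap {X : RelCat.{u}} (s : El (𝟙_ RelCat.{u})) (x y : El X) :
    Holds (cap X) (pr (cj x) y) s ↔ x = y := Iff.rfl

@[simp] theorem holds_conj {A B C : RelCat.{u}} (g : A ⟶ C ⊗ B) (a : El A) (b : El B) (c : El C) :
    Holds (conj g) (cj a) (pr (cj b) (cj c)) ↔ Holds g a (pr c b) := by
  simp [conj]

/-! ### Complete positivity for relations -/

theorem isCP_iff {A B : RelCat.{u}} (f : (ᘁA : RelCat.{u}) ⊗ A ⟶ (ᘁB : RelCat.{u}) ⊗ B) :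
    IsCP f ↔ ∀ x x' y y', Holds f (pr (cj x) x') (pr (cj y) y') →
      Holds f (pr (cj x') x) (pr (cj y') y) ∧ Holds f (pr (cj x) x) (pr (cj y) y) := by
  constructor
  · rintro ⟨C, g, rfl⟩ x x' y y'
    simp
    grind
  · intro h
    refine ⟨relOf {p : (El A × El B) × (El A × El B) //
      Holds f (pr (cj p.1.1) p.2.1) (pr (cj p.1.2) p.2.2)},
      rel fun a (q : _ × El B) => (a, q.2) = q.1.1.1 ∨ (a, q.2) = q.1.1.2, rel_ext ?_⟩
    simp only [all_pr, all_cj]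
    intro x x' y y'
    simp
    constructor
    · intro hf
      exact ⟨⟨((x, y), (x', y')), hf⟩, Or.inl rfl, Or.inr rfl⟩
    · rintro ⟨⟨⟨⟨a, b⟩, ⟨a', b'⟩⟩, hc⟩, h1, h2⟩
      have h3 := h _ _ _ _ hc
      have h4 := h _ _ _ _ h3.1
      have h1' : (x, y) = (a, b) ∨ (x, y) = (a', b') := h1
      have h2' : (x', y') = (a, b) ∨ (x', y') = (a', b') := h2
      simp only [Prod.mk.injEq] at h1' h2'
      rcases h1' with ⟨rfl, rfl⟩ | ⟨rfl, rfl⟩ <;> rcases h2' with ⟨rfl, rfl⟩ | ⟨rfl, rfl⟩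
      · exact h3.2
      · exact hc
      · exact h3.1
      · exact h4.2

theorem isCP_id (A : RelCat.{u}) : IsCP (𝟙 ((ᘁA : RelCat.{u}) ⊗ A)) := by
  rw [isCP_iff]
  simp

theorem IsCP.comp {A B C : RelCat.{u}} {f : (ᘁA : RelCat.{u}) ⊗ A ⟶ (ᘁB : RelCat.{u}) ⊗ B}
    {g : (ᘁB : RelCat.{u}) ⊗ B ⟶ (ᘁC : RelCat.{u}) ⊗ C} (hf : IsCP f) (hg : IsCP g) :
    IsCP (f ≫ g) := by
  rw [isCP_iff] at *
  intro x x' y y'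
  simp only [holds_comp, ex_pr, ex_cj]
  rintro ⟨z, z', h1, h2⟩
  exact ⟨⟨z', z, (hf _ _ _ _ h1).1, (hg _ _ _ _ h2).1⟩,
    ⟨z, z, (hf _ _ _ _ h1).2, (hg _ _ _ _ h2).2⟩⟩

instance : Category (CPM RelCat.{u}) where
  Hom := CPM.Hom
  id A := ⟨𝟙 _, isCP_id _⟩
  comp f g := ⟨f.hom ≫ g.hom, f.cp.comp g.cp⟩
  id_comp f := CPM.Hom.ext (Category.id_comp f.hom)
  comp_id f := CPM.Hom.ext (Category.comp_id f.hom)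
  assoc f g h := CPM.Hom.ext (Category.assoc f.hom g.hom h.hom)
/-! ### Frobenius algebras in relations -/

/-- The axioms of a normal dagger Frobenius algebra in `RelCat` in terms of elements. -/
structure RelFrob {α : Type u} (M : α → α → α → Prop) (U : α → Prop) : Prop where
  assoc : ∀ a b c d, (∃ e, M a b e ∧ M e c d) ↔ ∃ e, M b c e ∧ M a e d
  unit_mul : ∀ a b, (∃ k, U k ∧ M k a b) ↔ a = b
  mul_unit : ∀ a b, (∃ k, U k ∧ M a k b) ↔ a = b
  frob_left : ∀ a b c d, (∃ e, M e d b ∧ M a e c) ↔ ∃ h, M a b h ∧ M c d h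
  frob_right : ∀ a b c d, (∃ e, M c e a ∧ M e b d) ↔ ∃ h, M a b h ∧ M c d h
  normal : ∀ h, (∃ a, M a h a) ↔ U h

namespace RelFrob

variable {α : Type u} {M : α → α → α → Prop} {U : α → Prop}

theorem exists_inv (H : RelFrob M U) (a : α) : ∃ a' k, U k ∧ M a' a k := by
  obtain ⟨k, hk, hak⟩ := (H.mul_unit a a).2 rfl
  obtain ⟨k', hk', hka⟩ := (H.unit_mul a a).2 rfl
  obtain ⟨e, h1, h2⟩ := (H.frob_right k' a a k).2 ⟨a, hka, hak⟩
  exact ⟨e, k, hk, h2⟩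

theorem exists_inv' (H : RelFrob M U) (a : α) : ∃ a' k, U k ∧ M a a' k := by
  obtain ⟨k, hk, hak⟩ := (H.mul_unit a a).2 rfl
  obtain ⟨k', hk', hka⟩ := (H.unit_mul a a).2 rfl
  obtain ⟨e, h1, h2⟩ := (H.frob_right k' a a k).2 ⟨a, hka, hak⟩
  exact ⟨e, k', hk', h1⟩

theorem mulLeft (H : RelFrob M U) {a b c d h : α} (h1 : M a h b) (h2 : M c h d) :
    ∃ x, M x a c ∧ M x b d := by
  obtain ⟨a', k, hk, hak⟩ := H.exists_inv a
  obtain ⟨h', h3, h4⟩ := (H.frob_left a' b k h).1 ⟨a, h1, hak⟩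
  obtain rfl := (H.unit_mul h h').1 ⟨k, hk, h4⟩
  obtain ⟨x, h5, h6⟩ := (H.assoc c a' b d).2 ⟨h, h3, h2⟩
  obtain ⟨y, h7, h8⟩ := (H.frob_right x a c k).1 ⟨a', h5, hak⟩
  obtain rfl := (H.mul_unit c y).1 ⟨k, hk, h8⟩
  exact ⟨x, h7, h6⟩

theorem mulRight (H : RelFrob M U) {a b c d h : α} (h1 : M h a b) (h2 : M h c d) :
    ∃ x, M a x c ∧ M b x d := by
  obtain ⟨a', k, hk, hak⟩ := H.exists_inv' a
  obtain ⟨h', h3, h4⟩ := (H.frob_right b a' h k).1 ⟨a, h1, hak⟩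
  obtain rfl := (H.mul_unit h h').1 ⟨k, hk, h4⟩
  obtain ⟨x, h5, h6⟩ := (H.assoc b a' c d).1 ⟨h, h3, h2⟩
  obtain ⟨y, h7, h8⟩ := (H.frob_left a x k c).1 ⟨a', h5, hak⟩
  obtain rfl := (H.unit_mul c y).1 ⟨k, hk, h8⟩
  exact ⟨x, h7, h6⟩

theorem isometry (H : RelFrob M U) (h h' : α) : (∃ a b, M a h b ∧ M a h' b) ↔ h = h' := by
  constructor
  · rintro ⟨a, b, h1, h2⟩
    obtain ⟨k, h3, h4⟩ := (H.frob_left a h a h').2 ⟨b, h1, h2⟩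
    exact ((H.unit_mul h' h).1 ⟨k, (H.normal k).1 ⟨a, h4⟩, h3⟩).symm
  · rintro rfl
    obtain ⟨k, hk, h3⟩ := (H.unit_mul h h).2 rfl
    obtain ⟨a, ha⟩ := (H.normal k).2 hk
    obtain ⟨b, h4, h5⟩ := (H.frob_left a h a h).1 ⟨k, h3, ha⟩
    exact ⟨a, b, h4, h5⟩

end RelFrob

/-- A positive isomorphism in `RelCat` is an identity. -/
theorem positive_iso_eq_id {A : RelCat.{u}} (n : A ≅ A) (hn : IsPositive n.hom) :
    n.hom = 𝟙 A := by
  obtain ⟨B, h, hh⟩ := hn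
  have hd : ∀ x y, Holds n.hom x y → Holds n.hom x x := by
    intro x y hxy
    rw [hh] at hxy ⊢
    obtain ⟨z, h1, -⟩ := hxy
    exact ⟨z, h1, h1⟩
  have e1 : ∀ x y, (∃ z, Holds n.hom x z ∧ Holds n.inv z y) ↔ x = y := fun x y => by
    rw [← holds_comp, n.hom_inv_id, holds_id]
  have e2 : ∀ x y, (∃ z, Holds n.inv x z ∧ Holds n.hom z y) ↔ x = y := fun x y => by
    rw [← holds_comp, n.inv_hom_id, holds_id]
  refine rel_ext fun x y => ?_
  simp only [holds_id]
  constructor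
  · intro hxy
    obtain ⟨z, h1, h2⟩ := (e1 x x).2 rfl
    obtain ⟨w, h3, h4⟩ := (e2 y y).2 rfl
    have hx := hd x y hxy
    have hwx := (e1 x w).1 ⟨y, hxy, h3⟩
    subst hwx
    have hzx := (e2 z y).1 ⟨x, h2, hxy⟩
    have hzx' := (e2 z x).1 ⟨x, h2, hx⟩
    exact hzx'.symm.trans hzx
  · rintro rfl
    obtain ⟨z, h1, h2⟩ := (e1 x x).2 rfl
    exact hd x z h1

namespace CPStar

/-- `x y` is a product of `a` and `b`, for the elements of a Frobenius algebra in `RelCat`. -/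
def M (A : CPStar RelCat.{u}) (a b c : El A.carrier) : Prop := Holds A.mul (pr a b) c

/-- `k` is a unit element of a Frobenius algebra in `RelCat`. -/
def U (A : CPStar RelCat.{u}) (k : El A.carrier) : Prop := Holds A.unit st k

@[simp] theorem holds_action (A : CPStar RelCat.{u}) (h a b : El A.carrier) :
    Holds A.action h (pr (cj a) b) ↔ A.M a h b := by
  simp [DaggerFrobenius.action, M]

@[simp] theorem holds_coaction (A : CPStar RelCat.{u}) (h a b : El A.carrier) :
    Holds A.coaction (pr (cj a) b) h ↔ A.M a h b :=
  holds_action A h a b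

theorem holds_congr {X Y : RelCat.{u}} {f g : X ⟶ Y} (h : f = g) (x : El X) (y : El Y) :
    Holds f x y ↔ Holds g x y := by rw [h]

theorem relFrob (A : CPStar RelCat.{u}) : RelFrob A.M A.U where
  assoc a b c d := by
    have := holds_congr A.mul_assoc (pr (pr a b) c) d
    simpa [M] using this
  unit_mul a b := by
    have := holds_congr A.unit_mul (pr st a) b
    simpa [M, U] using this
  mul_unit a b := by
    have := holds_congr A.mul_unit (pr a st) b
    simpa [M, U] using this
  frob_left a b c d := by
    have := holds_congr A.frobenius_left (pr a b) (pr c d)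
    simpa [M] using this
  frob_right a b c d := by
    have := holds_congr A.frobenius_right (pr a b) (pr c d)
    simpa [M] using this
  normal h := by
    have := holds_congr A.normalisable h st
    rw [positive_iso_eq_id A.norm A.norm_positive] at this
    simpa [U] using this

theorem action_coaction (A : CPStar RelCat.{u}) : A.action ≫ A.coaction = 𝟙 _ :=
  rel_ext fun h h' => by
    simpa using A.relFrob.isometry h h'

theorem isCP_coaction_action (A : CPStar RelCat.{u}) : IsCP (A.coaction ≫ A.action) := by
  rw [isCP_iff]
  intro a b c d
  simp only [holds_comp, holds_coaction, holds_action]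
  rintro ⟨h, h1, h2⟩
  obtain ⟨x, h3, h4⟩ := A.relFrob.mulLeft h1 h2
  exact ⟨A.relFrob.mulRight h4 h3, A.relFrob.mulRight h3 h3⟩

instance : Category (CPStar RelCat.{u}) where
  Hom := CPStar.Hom
  id A := ⟨𝟙 _, by rw [Category.id_comp]; exact isCP_coaction_action A⟩
  comp {A B C} f g := ⟨f.hom ≫ g.hom, by
    have h := f.cp.comp g.cp
    simp only [Category.assoc] at h
    rw [← Category.assoc B.action, action_coaction, Category.id_comp] at h
    simpa only [Category.assoc] using h⟩
  id_comp f := CPStar.Hom.ext (Category.id_comp f.hom)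
  comp_id f := CPStar.Hom.ext (Category.comp_id f.hom)
  assoc f g h := CPStar.Hom.ext (Category.assoc f.hom g.hom h.hom)

/-- A ternary relation as a multiplication. -/
def mulRel {X : RelCat.{u}} (M : El X → El X → El X → Prop) : X ⊗ X ⟶ X :=
  rel fun (p : El X × El X) c => M p.1 p.2 c

/-- A subset as a morphism from the unit object. -/
def unitRel {X : RelCat.{u}} (U : El X → Prop) : 𝟙_ RelCat.{u} ⟶ X := rel fun _ k => U k

@[simp] theorem holds_mulRel {X : RelCat.{u}} (M : El X → El X → El X → Prop) (a b c : El X) :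
    Holds (mulRel M) (pr a b) c ↔ M a b c := Iff.rfl

@[simp] theorem holds_unitRel {X : RelCat.{u}} (U : El X → Prop) (s : El (𝟙_ RelCat.{u}))
    (k : El X) : Holds (unitRel U) s k ↔ U k := Iff.rfl

/-- The object of `CP*[Rel]` with a given ternary multiplication relation and set of units,
with the identity as its normaliser. -/
def ofRelFrob (X : RelCat.{u}) (M : El X → El X → El X → Prop) (U : El X → Prop)
    (H : RelFrob M U) : CPStar RelCat.{u} where
  carrier := X
  mul := mulRel M
  unit := unitRel U
  mul_assoc := rel_ext (by
    simp only [all_pr]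
    intro a b c d
    simpa using H.assoc a b c d)
  unit_mul := rel_ext (by
    simp only [all_pr, all_st]
    intro a b
    simpa using H.unit_mul a b)
  mul_unit := rel_ext (by
    simp only [all_pr, all_st]
    intro a b
    simpa using H.mul_unit a b)
  frobenius_left := rel_ext (by
    simp only [all_pr]
    intro a b c d
    simpa using H.frob_left a b c d)
  frobenius_right := rel_ext (by
    simp only [all_pr]
    intro a b c d
    simpa using H.frob_right a b c d)
  norm := Iso.refl _
  norm_central := by simp [DaggerFrobenius.IsCentral]
  norm_positive := ⟨X, 𝟙 X, rel_ext (by simp [eq_comm])⟩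
  normalisable := rel_ext (by
    simp only [all_st]
    intro h
    simpa [DaggerFrobenius.action] using H.normal h)

/-! ### Groupoids as objects of `CP*[Rel]` -/

section Groupoid

universe w₁ w₂

/-- The set of morphisms of a small groupoid. -/
abbrev Mor (G : Type w₁) [Groupoid.{w₂} G] : Type (max w₁ w₂) := Σ x y : G, x ⟶ y

variable {G : Type w₁} [Groupoid.{w₂} G]

/-- The composition of a groupoid as a ternary relation on its morphisms. -/
inductive GMul : Mor G → Mor G → Mor G → Prop
  | mk {x y z : G} (f : x ⟶ y) (g : y ⟶ z) : GMul ⟨x, y, f⟩ ⟨y, z, g⟩ ⟨x, z, f ≫ g⟩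

/-- The identities of a groupoid. -/
inductive GUnit : Mor G → Prop
  | mk (x : G) : GUnit ⟨x, x, 𝟙 x⟩

theorem gMul_iff {x y z : G} (f : x ⟶ y) (g : y ⟶ z) (p : Mor G) :
    GMul ⟨x, y, f⟩ ⟨y, z, g⟩ p ↔ p = ⟨x, z, f ≫ g⟩ := by
  constructor
  · intro h; cases h; rfl
  · rintro rfl; exact .mk f g

theorem gMul_inv {p q r : Mor G} (h : GMul p q r) :
    ∃ x y, ∃ f : x ⟶ y, ∃ z, ∃ g : y ⟶ z,
      p = ⟨x, y, f⟩ ∧ q = ⟨y, z, g⟩ ∧ r = ⟨x, z, f ≫ g⟩ := by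
  cases h with
  | mk f g => exact ⟨_, _, f, _, g, rfl, rfl, rfl⟩

theorem relFrob_groupoid : RelFrob (GMul (G := G)) GUnit where
  assoc a b c d := by
    constructor
    · rintro ⟨_, ⟨f, g⟩, ⟨_, h⟩⟩
      exact ⟨_, .mk g h, by rw [Category.assoc]; exact .mk f (g ≫ h)⟩
    · rintro ⟨_, ⟨g, h⟩, ⟨f, _⟩⟩
      exact ⟨_, .mk f g, by rw [← Category.assoc]; exact .mk (f ≫ g) h⟩
  unit_mul a b := by
    constructor
    · rintro ⟨_, ⟨x⟩, ⟨_, f⟩⟩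
      rw [Category.id_comp]
    · rintro rfl
      obtain ⟨x, y, f⟩ := a
      exact ⟨_, .mk x, by simpa using GMul.mk (𝟙 x) f⟩
  mul_unit a b := by
    constructor
    · rintro ⟨_, ⟨x⟩, ⟨f, _⟩⟩
      rw [Category.comp_id]
    · rintro rfl
      obtain ⟨x, y, f⟩ := a
      exact ⟨_, .mk y, by simpa using GMul.mk f (𝟙 y)⟩
  frob_left a b c d := by
    constructor
    · rintro ⟨_, ⟨e, d⟩, ⟨a, _⟩⟩
      exact ⟨_, .mk a (e ≫ d), by rw [← Category.assoc]; exact .mk (a ≫ e) d⟩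
    · rintro ⟨_, ⟨a, b⟩, h⟩
      obtain ⟨x, y, c⟩ := c
      obtain ⟨y', z, d⟩ := d
      generalize hq : (⟨_, _, a ≫ b⟩ : Mor G) = q at h
      cases h
      simp only [Sigma.mk.injEq] at hq
      obtain ⟨rfl, hq⟩ := hq
      simp only [heq_eq_eq, Sigma.mk.injEq] at hq
      obtain ⟨rfl, hq⟩ := hq
      simp only [heq_eq_eq] at hq
      refine ⟨⟨_, _, inv a ≫ c⟩, ?_, ?_⟩
      · rw [gMul_iff, Category.assoc, ← hq]; simp
      · rw [gMul_iff]; simp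
  frob_right a b c d := by
    constructor
    · rintro ⟨_, ⟨c, e⟩, ⟨_, b⟩⟩
      exact ⟨_, .mk (c ≫ e) b, by rw [Category.assoc]; exact .mk c (e ≫ b)⟩
    · rintro ⟨_, ⟨a, b⟩, h⟩
      obtain ⟨x, y, c⟩ := c
      obtain ⟨y', z, d⟩ := d
      generalize hq : (⟨_, _, a ≫ b⟩ : Mor G) = q at h
      cases h
      simp only [Sigma.mk.injEq] at hq
      obtain ⟨rfl, hq⟩ := hq
      simp only [heq_eq_eq, Sigma.mk.injEq] at hq
      obtain ⟨rfl, hq⟩ := hq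
      simp only [heq_eq_eq] at hq
      refine ⟨⟨_, _, inv c ≫ a⟩, ?_, ?_⟩
      · rw [gMul_iff]; simp
      · rw [gMul_iff, Category.assoc, hq]; simp
  normal h := by
    constructor
    · rintro ⟨a, h1⟩
      obtain ⟨x, y, f, z, g, h2, h3, h4⟩ :
          ∃ x y, ∃ f : x ⟶ y, ∃ z, ∃ g : y ⟶ z,
            a = ⟨x, y, f⟩ ∧ h = ⟨y, z, g⟩ ∧ a = ⟨x, z, f ≫ g⟩ := by
        exact gMul_inv h1
      rw [h2] at h4
      simp only [Sigma.mk.injEq, heq_eq_eq, true_and] at h4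
      obtain ⟨rfl, h4⟩ := h4
      have h5 : g = 𝟙 y := by
        rw [← cancel_epi f, ← eq_of_heq h4, Category.comp_id]
      rw [h3, h5]
      exact .mk y
    · rintro ⟨x⟩
      exact ⟨⟨x, x, 𝟙 x⟩, by rw [gMul_iff]; simp⟩

/-- A small groupoid as an object of `CP*[Rel]`: its set of morphisms with composition as
multiplication and identities as units. -/
def ofGroupoid (G : Type w₁) [Groupoid.{w₂} G] : CPStar RelCat.{max w₁ w₂} :=
  ofRelFrob (relOf (Mor G)) GMul GUnit relFrob_groupoid

end Groupoid

end CPStar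

/-- The indiscrete groupoid on a set: exactly one morphism between any two elements. -/
instance (X : Type*) : Groupoid (Codiscrete X) where
  inv _ := ⟨⟩

/-- The disjoint union of a family of groupoids. -/
instance {ι : Type*} (C : ι → Type*) [∀ i, Groupoid (C i)] : Groupoid (Σ i, C i) where
  inv := fun {X Y} f => match X, Y, f with
    | _, _, .mk f => .mk (Groupoid.inv f)
  inv_comp := by
    rintro _ _ ⟨f⟩
    exact congrArg Sigma.SigmaHom.mk (Groupoid.inv_comp f)
  comp_inv := by
    rintro _ _ ⟨f⟩
    exact congrArg Sigma.SigmaHom.mk (Groupoid.comp_inv f)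

/-! ### The biproduct completion -/

section Biproduct

/-- A category enriched in commutative monoids. -/
class CMonEnriched (C : Type u) [Category.{v} C] where
  homMonoid (X Y : C) : AddCommMonoid (X ⟶ Y)
  zero_comp {X Y Z : C} (g : Y ⟶ Z) : (0 : X ⟶ Y) ≫ g = 0
  comp_zero {X Y Z : C} (f : X ⟶ Y) : f ≫ (0 : Y ⟶ Z) = 0
  add_comp {X Y Z : C} (f f' : X ⟶ Y) (g : Y ⟶ Z) : (f + f') ≫ g = f ≫ g + f' ≫ g
  comp_add {X Y Z : C} (f : X ⟶ Y) (g g' : Y ⟶ Z) : f ≫ (g + g') = f ≫ g + f ≫ g'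

attribute [reducible, instance] CMonEnriched.homMonoid

variable (C : Type u) [Category.{v} C]

/-- Objects of the biproduct completion `C^⊕`: finite families of objects of `C`. -/
structure BiprodCompletion where
  ι : Type
  [fintype : Fintype ι]
  X : ι → C

attribute [instance] BiprodCompletion.fintype

variable {C}

/-- Morphisms of the biproduct completion: matrices of morphisms. -/
@[ext]
structure BiprodCompletion.Hom (A B : BiprodCompletion C) where
  entry (i : A.ι) (j : B.ι) : A.X i ⟶ B.X j

variable [CMonEnriched C]

theorem sum_comp' {X Y Z : C} {ι : Type} (s : Finset ι) (f : ι → (X ⟶ Y)) (g : Y ⟶ Z) :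
    (∑ i ∈ s, f i) ≫ g = ∑ i ∈ s, f i ≫ g := by
  classical
  induction s using Finset.induction_on with
  | empty => simp [CMonEnriched.zero_comp]
  | insert a s ha ih => rw [Finset.sum_insert ha, Finset.sum_insert ha, CMonEnriched.add_comp, ih]

theorem comp_sum' {X Y Z : C} {ι : Type} (s : Finset ι) (f : X ⟶ Y) (g : ι → (Y ⟶ Z)) :
    f ≫ (∑ i ∈ s, g i) = ∑ i ∈ s, f ≫ g i := by
  classical
  induction s using Finset.induction_on with
  | empty => simp [CMonEnriched.comp_zero]
  | insert a s ha ih => rw [Finset.sum_insert ha, Finset.sum_insert ha, CMonEnriched.comp_add, ih]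

open scoped Classical in
/-- The biproduct completion: the identity matrix has identities on the diagonal and zeros
elsewhere, and composition is matrix multiplication. -/
noncomputable instance : Category (BiprodCompletion C) where
  Hom := BiprodCompletion.Hom
  id A := ⟨fun i j => if h : i = j then eqToHom (congrArg A.X h) else 0⟩
  comp {_ B _} f g := ⟨fun i k => ∑ j : B.ι, f.entry i j ≫ g.entry j k⟩
  id_comp {A B} f := by
    ext i k
    change ∑ j : A.ι, _ = _
    rw [Finset.sum_eq_single i]
    · simp
    · intro j _ hj
      simp [hj.symm, CMonEnriched.zero_comp]
    · simp
  comp_id {A B} f := by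
    ext i k
    change ∑ j : B.ι, _ = _
    rw [Finset.sum_eq_single k]
    · simp
    · intro j _ hj
      simp [hj, CMonEnriched.comp_zero]
    · simp
  assoc {A B C D} f g h := by
    ext i l
    change ∑ k, (∑ j, f.entry i j ≫ g.entry j k) ≫ h.entry k l =
      ∑ j, f.entry i j ≫ ∑ k, g.entry j k ≫ h.entry k l
    simp only [sum_comp', comp_sum', Category.assoc]
    exact Finset.sum_comm

end Biproduct

section
variable {A B : CPM RelCat.{u}}

/-- The empty relation. -/
instance : Zero (A ⟶ B) := ⟨⟨rel fun _ _ => False, by rw [isCP_iff]; simp⟩⟩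

/-- The union of relations. -/
instance : Add (A ⟶ B) := ⟨fun f g => ⟨rel fun x y => Holds f.hom x y ∨ Holds g.hom x y, by
  have hf := f.cp
  have hg := g.cp
  rw [isCP_iff] at *
  intro x x' y y'
  simp only [holds_rel]
  rintro (h | h)
  · exact ⟨.inl (hf _ _ _ _ h).1, .inl (hf _ _ _ _ h).2⟩
  · exact ⟨.inr (hg _ _ _ _ h).1, .inr (hg _ _ _ _ h).2⟩⟩⟩

theorem cpm_ext {f g : A ⟶ B} (h : ∀ x y, Holds f.hom x y ↔ Holds g.hom x y) : f = g :=
  CPM.Hom.ext (rel_ext h)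

theorem holds_cpm_zero (x y) : ¬ Holds (0 : A ⟶ B).hom x y := id

theorem holds_cpm_add (f g : A ⟶ B) (x y) :
    Holds (f + g).hom x y ↔ Holds f.hom x y ∨ Holds g.hom x y := Iff.rfl

theorem holds_cpm_id (x y) : Holds (𝟙 A : A ⟶ A).hom x y ↔ x = y := Iff.rfl

theorem holds_cpm_comp {C : CPM RelCat.{u}} (f : A ⟶ B) (g : B ⟶ C) (x y) :
    Holds (f ≫ g).hom x y ↔ ∃ z, Holds f.hom x z ∧ Holds g.hom z y := Iff.rfl

instance : AddCommMonoid (A ⟶ B) where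
  add_assoc _ _ _ := cpm_ext fun _ _ => or_assoc
  zero_add _ := cpm_ext fun _ _ => by simp [holds_cpm_add, holds_cpm_zero]
  add_zero _ := cpm_ext fun _ _ => by simp [holds_cpm_add, holds_cpm_zero]
  add_comm _ _ := cpm_ext fun _ _ => or_comm
  nsmul := nsmulRec

end

/-- `CPM[Rel]` inherits its enrichment from the biproducts of `Rel` (disjoint unions): the sum of
parallel morphisms is the union of relations, and the zero morphism is the empty relation. -/
instance : CMonEnriched (CPM RelCat.{u}) where
  homMonoid _ _ := inferInstance
  zero_comp _ := cpm_ext fun x y => by simp [holds_cpm_comp, holds_cpm_zero]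
  comp_zero _ := cpm_ext fun x y => by simp [holds_cpm_comp, holds_cpm_zero]
  add_comp _ _ _ := cpm_ext fun x y => by
    simp only [holds_cpm_comp, holds_cpm_add, or_and_right, exists_or]
  comp_add _ _ _ := cpm_ext fun x y => by
    simp only [holds_cpm_comp, holds_cpm_add, and_or_left, exists_or]

theorem holds_cpm_sum {A B : CPM RelCat.{u}} {ι : Type} (s : Finset ι) (f : ι → (A ⟶ B)) (x y) :
    Holds (∑ i ∈ s, f i).hom x y ↔ ∃ i ∈ s, Holds (f i).hom x y := by
  classical
  induction s using Finset.induction_on with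
  | empty => simpa using holds_cpm_zero x y
  | insert a s ha ih =>
    rw [Finset.sum_insert ha]
    simp only [Finset.mem_insert, exists_eq_or_imp, ← ih]
    exact holds_cpm_add _ _ x y

/-! ### The functor from the biproduct completion of `CPM[Rel]` to `CP*[Rel]` -/

namespace CPStar

/-- The multiplication `A* ⊗ ε ⊗ A : (A* ⊗ A) ⊗ (A* ⊗ A) ⟶ A* ⊗ A`. -/
def pantsMul (A : RelCat.{u}) : ((ᘁA : RelCat.{u}) ⊗ A) ⊗ ((ᘁA : RelCat.{u}) ⊗ A) ⟶
    (ᘁA : RelCat.{u}) ⊗ A :=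
  (α_ _ _ _).hom ≫ (_ ◁ (α_ _ _ _).inv) ≫ (_ ◁ (ε_ (ᘁA : RelCat.{u}) A ▷ A)) ≫
    (_ ◁ (λ_ A).hom)

@[simp] theorem holds_pantsMul {A : RelCat.{u}} (a b c d e f : El A) :
    Holds (pantsMul A) (pr (pr (cj a) b) (pr (cj c) d)) (pr (cj e) f) ↔
      a = e ∧ b = c ∧ d = f := by
  simp [pantsMul]
  try grind

/-- The algebra of pairs of pants on `A* ⊗ A`. -/
def pantsFrobenius (A : RelCat.{u}) : DaggerFrobenius RelCat.{u} where
  carrier := (ᘁA : RelCat.{u}) ⊗ A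
  mul := pantsMul A
  unit := η_ (ᘁA : RelCat.{u}) A
  mul_assoc := rel_ext (by
    simp only [all_pr, all_cj]
    intros
    simp
    try grind)
  unit_mul := rel_ext (by
    simp only [all_pr, all_cj, all_st]
    intros
    simp
    try grind)
  mul_unit := rel_ext (by
    simp only [all_pr, all_cj, all_st]
    intros
    simp
    try grind)
  frobenius_left := rel_ext (by
    simp only [all_pr, all_cj]
    intros
    simp
    try grind)
  frobenius_right := rel_ext (by
    simp only [all_pr, all_cj]
    intros
    simp
    try grind)

theorem holds_trace (D : DaggerFrobenius RelCat.{u}) (h : El D.carrier) :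
    Holds (D.action ≫ cap D.carrier) h st ↔ ∃ a, Holds D.mul (pr a h) a := by
  simp [DaggerFrobenius.action]

/-- The algebra of pairs of pants as an object of `CP*[Rel]`. -/
def pants (A : RelCat.{u}) : CPStar RelCat.{u} where
  toDaggerFrobenius := pantsFrobenius A
  norm := Iso.refl _
  norm_central := by simp [DaggerFrobenius.IsCentral]
  norm_positive := ⟨_, 𝟙 _, rel_ext fun x y => by
    simp only [Iso.refl_hom, holds_id, holds_comp, holds_dagger']
    grind⟩
  normalisable := rel_ext (by
    simp only [all_st, Iso.refl_hom, Category.id_comp]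
    intro h
    rw [holds_trace]
    obtain ⟨h, h'⟩ := h
    change (∃ a : El ((ᘁA : RelCat.{u}) ⊗ A), Holds (pantsMul A) (pr a (pr (cj h) h')) a) ↔ h = h'
    simp
    exact ⟨fun e => e.2.symm, fun e => ⟨⟨h'⟩, e.symm⟩⟩)

/-- Blockwise multiplication on a disjoint union. -/
inductive SumMul {ι : Type} (A : ι → CPStar RelCat.{u}) :
    (Σ i, El (A i).carrier) → (Σ i, El (A i).carrier) → (Σ i, El (A i).carrier) → Prop
  | mk {i : ι} {a b c : El (A i).carrier} (h : (A i).M a b c) : SumMul A ⟨i, a⟩ ⟨i, b⟩ ⟨i, c⟩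

/-- Blockwise units on a disjoint union. -/
inductive SumUnit {ι : Type} (A : ι → CPStar RelCat.{u}) : (Σ i, El (A i).carrier) → Prop
  | mk {i : ι} {k : El (A i).carrier} (h : (A i).U k) : SumUnit A ⟨i, k⟩

theorem relFrob_sum {ι : Type} (A : ι → CPStar RelCat.{u}) :
    RelFrob (SumMul A) (SumUnit A) where
  assoc a b c d := by
    constructor
    · rintro ⟨_, ⟨h⟩, ⟨h'⟩⟩
      obtain ⟨e, h1, h2⟩ := ((A _).relFrob.assoc _ _ _ _).1 ⟨_, h, h'⟩
      exact ⟨_, .mk h1, .mk h2⟩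
    · rintro ⟨_, ⟨h⟩, ⟨h'⟩⟩
      obtain ⟨e, h1, h2⟩ := ((A _).relFrob.assoc _ _ _ _).2 ⟨_, h, h'⟩
      exact ⟨_, .mk h1, .mk h2⟩
  unit_mul a b := by
    constructor
    · rintro ⟨_, ⟨h⟩, ⟨h'⟩⟩
      rw [((A _).relFrob.unit_mul _ _).1 ⟨_, h, h'⟩]
    · rintro rfl
      obtain ⟨i, a⟩ := a
      obtain ⟨k, h1, h2⟩ := ((A i).relFrob.unit_mul a a).2 rfl
      exact ⟨_, .mk h1, .mk h2⟩
  mul_unit a b := by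
    constructor
    · rintro ⟨_, ⟨h⟩, ⟨h'⟩⟩
      rw [((A _).relFrob.mul_unit _ _).1 ⟨_, h, h'⟩]
    · rintro rfl
      obtain ⟨i, a⟩ := a
      obtain ⟨k, h1, h2⟩ := ((A i).relFrob.mul_unit a a).2 rfl
      exact ⟨_, .mk h1, .mk h2⟩
  frob_left a b c d := by
    constructor
    · rintro ⟨_, ⟨h⟩, ⟨h'⟩⟩
      obtain ⟨e, h1, h2⟩ := ((A _).relFrob.frob_left _ _ _ _).1 ⟨_, h, h'⟩
      exact ⟨_, .mk h1, .mk h2⟩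
    · rintro ⟨_, ⟨h⟩, ⟨h'⟩⟩
      obtain ⟨e, h1, h2⟩ := ((A _).relFrob.frob_left _ _ _ _).2 ⟨_, h, h'⟩
      exact ⟨_, .mk h1, .mk h2⟩
  frob_right a b c d := by
    constructor
    · rintro ⟨_, ⟨h⟩, ⟨h'⟩⟩
      obtain ⟨e, h1, h2⟩ := ((A _).relFrob.frob_right _ _ _ _).1 ⟨_, h, h'⟩
      exact ⟨_, .mk h1, .mk h2⟩
    · rintro ⟨_, ⟨h⟩, ⟨h'⟩⟩
      obtain ⟨e, h1, h2⟩ := ((A _).relFrob.frob_right _ _ _ _).2 ⟨_, h, h'⟩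
      exact ⟨_, .mk h1, .mk h2⟩
  normal h := by
    constructor
    · rintro ⟨⟨i, a⟩, h1⟩
      cases h1 with
      | mk h1 => exact .mk (((A i).relFrob.normal _).1 ⟨_, h1⟩)
    · rintro ⟨h1⟩
      obtain ⟨a, ha⟩ := ((A _).relFrob.normal _).2 h1
      exact ⟨_, .mk ha⟩

/-- The direct sum of objects of `CP*[Rel]`: the disjoint union of the carriers, with blockwise
multiplication and units. -/
def directSum {ι : Type} (A : ι → CPStar RelCat.{u}) : CPStar RelCat.{u} :=
  ofRelFrob (relOf (Σ i, El (A i).carrier)) (SumMul A) (SumUnit A) (relFrob_sum A)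

@[simp] theorem pants_M {A : RelCat.{u}} (a b c d e f : El A) :
    (pants A).M (pr (cj a) b) (pr (cj c) d) (pr (cj e) f) ↔ a = e ∧ b = c ∧ d = f := holds_pantsMul a b c d e f

end CPStar

/-- The matrix of relations `f` as a relation between disjoint unions. -/
def sumRel {A B : BiprodCompletion (CPM RelCat.{u})} (f : A ⟶ B) :
    (CPStar.directSum fun i => CPStar.pants (A.X i).of).carrier ⟶
      (CPStar.directSum fun j => CPStar.pants (B.X j).of).carrier :=
  rel fun (p : Σ i, El ((ᘁ(A.X i).of : RelCat.{u}) ⊗ (A.X i).of))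
    (q : Σ j, El ((ᘁ(B.X j).of : RelCat.{u}) ⊗ (B.X j).of)) =>
      Holds (f.entry p.1 q.1).hom p.2 q.2

theorem sumRel_cp {A B : BiprodCompletion (CPM RelCat.{u})} (f : A ⟶ B) :
    IsCP ((CPStar.directSum fun i => CPStar.pants (A.X i).of).coaction ≫ sumRel f ≫
      (CPStar.directSum fun j => CPStar.pants (B.X j).of).action) := by
  rw [isCP_iff]
  intro a b c d
  simp only [holds_comp, CPStar.holds_coaction, CPStar.holds_action]
  rintro ⟨h, h1, k, h2, h3⟩
  cases h1 with
  | @mk i a h b h1 =>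
  cases h3 with
  | @mk j c k d h3 =>
  obtain ⟨a1, a2⟩ := a
  obtain ⟨b1, b2⟩ := b
  obtain ⟨c1, c2⟩ := c
  obtain ⟨d1, d2⟩ := d
  obtain ⟨h, h'⟩ := h
  obtain ⟨k, k'⟩ := k
  obtain ⟨rfl, rfl, rfl⟩ := (CPStar.pants_M _ _ _ _ _ _).1 h1
  obtain ⟨rfl, rfl, rfl⟩ := (CPStar.pants_M _ _ _ _ _ _).1 h3
  have h4 := (isCP_iff _).1 (f.entry i j).cp _ _ _ _ h2
  exact ⟨⟨⟨i, pr (cj h') a2⟩, .mk ((CPStar.pants_M _ _ _ _ _ _).2 ⟨rfl, rfl, rfl⟩),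
      ⟨j, pr (cj k') c2⟩, h4.1, .mk ((CPStar.pants_M _ _ _ _ _ _).2 ⟨rfl, rfl, rfl⟩)⟩,
    ⟨⟨i, pr (cj a2) a2⟩, .mk ((CPStar.pants_M _ _ _ _ _ _).2 ⟨rfl, rfl, rfl⟩),
      ⟨j, pr (cj c2) c2⟩, h4.2, .mk ((CPStar.pants_M _ _ _ _ _ _).2 ⟨rfl, rfl, rfl⟩)⟩⟩

/-- The canonical functor `CPM[Rel]^⊕ ⥤ CP*[Rel]`: the extension to biproducts of the functor that
sends `A` to the algebra on `A* ⊗ A` and a completely positive `f : A* ⊗ A ⟶ B* ⊗ B` to `f`. -/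
noncomputable def canonicalFunctor :
    BiprodCompletion (CPM RelCat.{u}) ⥤ CPStar RelCat.{u} where
  obj A := CPStar.directSum fun i => CPStar.pants (A.X i).of
  map f := ⟨sumRel f, sumRel_cp f⟩
  map_id A := by
    classical
    refine CPStar.Hom.ext (rel_ext ?_)
    rintro ⟨i, p⟩ ⟨j, q⟩
    change Holds (dite (i = j) _ _ : A.X i ⟶ A.X j).hom p q ↔
      (⟨i, p⟩ : Σ i, El ((ᘁ(A.X i).of : RelCat.{u}) ⊗ (A.X i).of)) = ⟨j, q⟩
    by_cases h : i = j
    · subst h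
      rw [dif_pos rfl, eqToHom_refl]
      exact ⟨fun e => congrArg (Sigma.mk i) e, fun e => eq_of_heq (Sigma.mk.inj e).2⟩
    · rw [dif_neg h]
      exact ⟨fun e => e.elim, fun e => absurd (Sigma.mk.inj e).1 h⟩
  map_comp {A B C} f g := by
    refine CPStar.Hom.ext (rel_ext ?_)
    rintro ⟨i, p⟩ ⟨k, q⟩
    change Holds (∑ j : B.ι, f.entry i j ≫ g.entry j k).hom p q ↔
      ∃ r : Σ j, El ((ᘁ(B.X j).of : RelCat.{u}) ⊗ (B.X j).of),
        Holds (f.entry i r.1).hom p r.2 ∧ Holds (g.entry r.1 k).hom r.2 q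
    refine (holds_cpm_sum _ _ _ _).trans ?_
    constructor
    · rintro ⟨j, -, r, h1, h2⟩
      exact ⟨⟨j, r⟩, h1, h2⟩
    · rintro ⟨⟨j, r⟩, h1, h2⟩
      exact ⟨j, Finset.mem_univ j, r, h1, h2⟩

end Rel

end CQM

/-! Everything rests on the diagonal clause of the criterion `isCP_iff`: if a completely positive
relation relates the pair (x, x') to (y, y'), then it relates (x, x) to (y, y). For a `CP*` morphism
f between groupoids this says that when p is related to q, the identity at the source of p is
related to the identity at the source of q (`exists_holds_of_mul_eq`, used with source identities).

An isomorphism in `CP*[Rel]` is the graph of a bijection. If its domain is a group, the single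
identity is related to the source identity of every morphism of the other groupoid H. A function has
only one value there, so H has one object, and the bijection counts its morphisms. This gives the
third claim. The fourth follows because an indiscrete groupoid with one object has just one
morphism.

Equivalences are excluded by a property of an endomorphism monoid that uses composition alone: it
has a zero and no zero divisors. A group has this property in `CP*[Rel]`, since every nonempty
endomorphism relates 1 to 1, and so composites of nonempty endomorphisms are nonempty. A nontrivial
group has at least three endomorphisms: the empty relation, the identity and the full relation. In
the biproduct completion of `CPM[Rel]`, two distinct points of a family give nonzero endomorphisms
with zero composite. An object with the property therefore has at most one point in all and at most
two endomorphisms. Hence `CP*[Rel]` admits no full and faithful functor to the completion. -/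

namespace CQM

/-! ### Isomorphisms and complete positivity in `CP*[Rel]` -/

namespace CPStar

/-- Since `e.hom ≫ e.inv` is an identity, each x has a loop through some element of B; that midpoint
is φ x. The loops at elements of B give the inverse, and a concatenation of two halves of loops
collapses because both composites are identities. -/
theorem exists_holds_of_iso {A B : CPStar RelCat.{u}} (e : A ≅ B) :
    ∃ φ : El A.carrier ≃ El B.carrier, ∀ x, Holds e.hom.hom x (φ x) := by
  have h₁ : ∀ x y, (∃ z, Holds e.hom.hom x z ∧ Holds e.inv.hom z y) ↔ x = y := fun x y =>
    holds_congr (congrArg CPStar.Hom.hom e.hom_inv_id) x y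
  have h₂ : ∀ x y, (∃ z, Holds e.inv.hom x z ∧ Holds e.hom.hom z y) ↔ x = y := fun x y =>
    holds_congr (congrArg CPStar.Hom.hom e.inv_hom_id) x y
  choose φ hφ hφ' using fun x => (h₁ x x).2 rfl
  choose ψ hψ hψ' using fun y => (h₂ y y).2 rfl
  refine ⟨⟨φ, ψ, fun x => ?_, fun y => ?_⟩, hφ⟩
  · exact ((h₁ _ _).1 ⟨_, hφ x, hψ _⟩).symm
  · exact ((h₂ _ _).1 ⟨_, hψ y, hφ _⟩).symm

/-- With the previous result, this makes `e.hom` the graph of a bijection: the loop at y must pass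
through x, so y returns to x under the inverse and then reaches y', forcing y = y'. -/
theorem holds_iso_unique {A B : CPStar RelCat.{u}} (e : A ≅ B) {x : El A.carrier}
    {y y' : El B.carrier} (h : Holds e.hom.hom x y) (h' : Holds e.hom.hom x y') : y = y' := by
  obtain ⟨z, hz, hz'⟩ := (holds_congr (congrArg CPStar.Hom.hom e.inv_hom_id) y y).2 rfl
  obtain ⟨w, hw, hw'⟩ := (holds_congr (congrArg CPStar.Hom.hom e.hom_inv_id) x x).2 rfl
  have hxz : x = z := (holds_congr (congrArg CPStar.Hom.hom e.hom_inv_id) x z).1 ⟨y, h, hz⟩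
  subst hxz
  exact (holds_congr (congrArg CPStar.Hom.hom e.inv_hom_id) y y').1 ⟨x, hz, h'⟩

/-- A morphism of `CP*[Rel]` relates units of the algebras fixing related elements. -/
theorem exists_holds_of_mul_eq {A B : CPStar RelCat.{u}} (f : A ⟶ B) {a h : El A.carrier}
    {b k : El B.carrier} (ha : A.M a h h) (hb : B.M b k k) (hf : Holds f.hom h k) :
    ∃ h' k', A.M a h' a ∧ Holds f.hom h' k' ∧ B.M b k' b := by
  -- The equations a h = h and b k = k make (a, h) related to (b, k) through h and k. The diagonal
  -- clause then relates (a, a) to (b, b), and h', k' are the intermediate elements.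
  obtain ⟨h', h₁, k', h₂, h₃⟩ := ((isCP_iff _).1 f.cp a h b k
    ⟨h, (holds_coaction _ _ _ _).2 ha, k, hf, (holds_action _ _ _ _).2 hb⟩).2
  exact ⟨h', k', (holds_coaction _ _ _ _).1 h₁, h₂, (holds_action _ _ _ _).1 h₃⟩

/-! ### Groupoids isomorphic to a group -/

section Groupoid

universe w₁ w₂

variable {G : Type w₁} [Groupoid.{w₂} G]

/-- The identity of the source of a morphism of a groupoid. -/
def sourceId (p : Mor G) : Mor G := ⟨p.1, p.1, 𝟙 p.1⟩

theorem sourceId_mul (p : Mor G) : (ofGroupoid G).M (sourceId p) p p :=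
  (gMul_iff _ _ _).2 (by simp)

theorem eq_sourceId_of_mul {p q : Mor G} (h : (ofGroupoid G).M (sourceId p) q (sourceId p)) :
    q = sourceId p := by
  obtain ⟨a, b, r, c, s, e₁, rfl, e₃⟩ := gMul_inv h
  cases e₁
  simp only [Category.id_comp] at e₃
  exact e₃.symm

end Groupoid

/-- A groupoid isomorphic to a group in `CP*[Rel]` has a single object, and as many morphisms as
the group has elements. -/
theorem card_of_iso_group {Γ : Type u} [Group Γ] {H : Type u} [Groupoid.{u} H]
    (e : ofGroupoid (SingleObj Γ) ≅ ofGroupoid H) :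
    Nat.card H = 1 ∧ Nat.card (Mor H) = Nat.card Γ := by
  obtain ⟨φ, hφ⟩ := exists_holds_of_iso e
  let φ' : Mor (SingleObj Γ) ≃ Mor H := φ
  have hφ' (p : Mor (SingleObj Γ)) : Holds e.hom.hom p (φ' p) := hφ p
  -- The elements fixing the source identities of p and φ' p on the right are those identities
  -- themselves, and a group has only one identity, whatever p is.
  have hid (p : Mor (SingleObj Γ)) : Holds e.hom.hom
      (⟨SingleObj.star Γ, SingleObj.star Γ, 𝟙 _⟩ : Mor (SingleObj Γ)) (sourceId (φ' p)) := by
    obtain ⟨h, k, h₁, h₂, h₃⟩ :=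
      exists_holds_of_mul_eq e.hom (sourceId_mul p) (sourceId_mul (φ' p)) (hφ' p)
    rw [eq_sourceId_of_mul h₁, eq_sourceId_of_mul h₃] at h₂
    exact h₂
  have hobj (x : H) : ∃ p, (φ' p).1 = x :=
    ⟨φ'.symm ⟨x, x, 𝟙 x⟩, by rw [Equiv.apply_symm_apply]⟩
  constructor
  · rw [Nat.card_eq_one_iff_unique]
    refine ⟨⟨fun x y => ?_⟩, ⟨(φ' ⟨SingleObj.star Γ, SingleObj.star Γ, 𝟙 _⟩).1⟩⟩
    obtain ⟨p, rfl⟩ := hobj x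
    obtain ⟨q, rfl⟩ := hobj y
    have h : sourceId (φ' p) = sourceId (φ' q) := holds_iso_unique e (hid p) (hid q)
    exact (Sigma.mk.inj h).1
  · let ψ : Γ ≃ Mor (SingleObj Γ) :=
      { toFun g := ⟨SingleObj.star Γ, SingleObj.star Γ, g⟩
        invFun p := p.2.2
        left_inv _ := rfl
        right_inv _ := rfl }
    exact (Nat.card_congr (ψ.trans φ')).symm

/-! ### Endomorphisms of a group in `CP*[Rel]` -/

/-- The empty relation as a morphism of `CP*[Rel]`. -/
def emptyHom (A B : CPStar RelCat.{u}) : A ⟶ B :=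
  ⟨rel fun _ _ => False, by
    rw [isCP_iff]
    rintro a b c d ⟨_, _, _, h, _⟩
    exact h.elim⟩

/-- The full relation on a group as a morphism of `CP*[Rel]`. -/
def fullHom (Γ : Type u) [Group Γ] :
    ofGroupoid (SingleObj Γ) ⟶ ofGroupoid (SingleObj Γ) :=
  ⟨rel fun _ _ => True, by
    -- Division in the group: h = a⁻¹ b. Consequently the full relation stays full between coaction
    -- and action, and complete positivity is automatic.
    have key : ∀ a b : Mor (SingleObj Γ), ∃ h, (ofGroupoid (SingleObj Γ)).M a h b := by
      rintro ⟨x, y, f⟩ ⟨x', z, g⟩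
      cases x
      cases x'
      exact ⟨(⟨y, z, inv f ≫ g⟩ : Mor (SingleObj Γ)), (gMul_iff _ _ _).2 (by simp)⟩
    have key' : ∀ a b c d : Mor (SingleObj Γ),
        Holds ((ofGroupoid (SingleObj Γ)).coaction ≫ (rel fun _ _ => True) ≫
          (ofGroupoid (SingleObj Γ)).action) (pr (cj a) b) (pr (cj c) d) := by
      intro a b c d
      obtain ⟨h, hh⟩ := key a b
      obtain ⟨k, hk⟩ := key c d
      exact ⟨h, (holds_coaction _ _ _ _).2 hh, k, trivial, (holds_action _ _ _ _).2 hk⟩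
    rw [isCP_iff]
    exact fun a b c d _ => ⟨key' _ _ _ _, key' _ _ _ _⟩⟩

theorem comp_emptyHom {A B C : CPStar RelCat.{u}} (f : A ⟶ B) :
    f ≫ emptyHom B C = emptyHom A C :=
  CPStar.Hom.ext (rel_ext fun _ _ => ⟨fun ⟨_, _, h⟩ => h, fun h => h.elim⟩)

theorem emptyHom_comp {A B C : CPStar RelCat.{u}} (f : B ⟶ C) :
    emptyHom A B ≫ f = emptyHom A C :=
  CPStar.Hom.ext (rel_ext fun _ _ => ⟨fun ⟨_, h, _⟩ => h, fun h => h.elim⟩)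

/-- Any related pair descends to its source identities, and in a group both are the unit. -/
theorem holds_one_of_ne_emptyHom {Γ : Type u} [Group Γ]
    {f : ofGroupoid (SingleObj Γ) ⟶ ofGroupoid (SingleObj Γ)} (hf : f ≠ emptyHom _ _) :
    Holds f.hom (⟨SingleObj.star Γ, SingleObj.star Γ, 𝟙 _⟩ : Mor (SingleObj Γ))
      (⟨SingleObj.star Γ, SingleObj.star Γ, 𝟙 _⟩ : Mor (SingleObj Γ)) := by
  by_contra h
  refine hf (CPStar.Hom.ext (rel_ext fun p q => ⟨fun hpq => h ?_, fun h => h.elim⟩))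
  obtain ⟨h', k', h₁, h₂, h₃⟩ := exists_holds_of_mul_eq f
    (sourceId_mul (G := SingleObj Γ) p) (sourceId_mul (G := SingleObj Γ) q) hpq
  rw [eq_sourceId_of_mul (G := SingleObj Γ) h₁, eq_sourceId_of_mul (G := SingleObj Γ) h₃] at h₂
  exact h₂

end CPStar

/-! ### A categorical invariant: absence of zero divisors -/

/-- The endomorphism monoid of `X` has a zero and no zero divisors. -/
def EndNoZeroDivisors {C : Type*} [Category C] (X : C) (z : X ⟶ X) : Prop :=
  (∀ f : X ⟶ X, f ≫ z = z ∧ z ≫ f = z) ∧ ∀ f g : X ⟶ X, f ≫ g = z → f = z ∨ g = z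

theorem EndNoZeroDivisors.map {C D : Type*} [Category C] [Category D] (F : C ⥤ D) [F.Full]
    [F.Faithful] {X : C} {z : X ⟶ X} (h : EndNoZeroDivisors X z) :
    EndNoZeroDivisors (F.obj X) (F.map z) := by
  constructor
  · intro f
    obtain ⟨f, rfl⟩ := F.map_surjective f
    rw [← F.map_comp, ← F.map_comp, (h.1 f).1, (h.1 f).2]
    exact ⟨rfl, rfl⟩
  · intro f g hfg
    obtain ⟨f, rfl⟩ := F.map_surjective f
    obtain ⟨g, rfl⟩ := F.map_surjective g
    rw [← F.map_comp] at hfg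
    exact (h.2 f g (F.map_injective hfg)).imp (congrArg F.map) (congrArg F.map)

/-- Nonempty f and g both relate 1 to 1, so their composite does too and cannot be empty. -/
theorem endNoZeroDivisors_group (Γ : Type u) [Group Γ] :
    EndNoZeroDivisors (CPStar.ofGroupoid (SingleObj Γ)) (CPStar.emptyHom _ _) := by
  refine ⟨fun f => ⟨CPStar.comp_emptyHom f, CPStar.emptyHom_comp f⟩, fun f g hfg => ?_⟩
  by_contra! h
  exact (CPStar.holds_congr (congrArg CPStar.Hom.hom hfg) _ _).1
    ⟨_, CPStar.holds_one_of_ne_emptyHom h.1, CPStar.holds_one_of_ne_emptyHom h.2⟩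

/-! ### Zero divisors in the biproduct completion of `CPM[Rel]` -/

section Biproduct

variable {A : BiprodCompletion (CPM RelCat.{u})}

/-- The endomorphism that relates `(x, x)` to itself, for a single point `x` of a family. -/
def pointHom (p : Σ i, El (A.X i).of) : A ⟶ A :=
  ⟨fun i j => ⟨rel fun (x : El (A.X i).of × El (A.X i).of) (y : El (A.X j).of × El (A.X j).of) =>
      (⟨i, x.1⟩ : Σ i, El (A.X i).of) = p ∧ (⟨i, x.2⟩ : Σ i, El (A.X i).of) = p ∧
      (⟨j, y.1⟩ : Σ i, El (A.X i).of) = p ∧ (⟨j, y.2⟩ : Σ i, El (A.X i).of) = p, by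
    rw [isCP_iff]
    rintro x x' y y' ⟨h₁, h₂, h₃, h₄⟩
    exact ⟨⟨h₂, h₁, h₄, h₃⟩, h₁, h₁, h₃, h₃⟩⟩⟩

/-- The zero matrix. -/
def zeroMatrix (A B : BiprodCompletion (CPM RelCat.{u})) : A ⟶ B := ⟨fun _ _ => 0⟩

theorem matrix_ext {B : BiprodCompletion (CPM RelCat.{u})} {f g : A ⟶ B}
    (h : ∀ i j x y, Holds (f.entry i j).hom x y ↔ Holds (g.entry i j).hom x y) : f = g :=
  BiprodCompletion.Hom.ext (funext fun i => funext fun j => cpm_ext (h i j))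

theorem holds_matrix_comp {B C : BiprodCompletion (CPM RelCat.{u})} (f : A ⟶ B) (g : B ⟶ C)
    (i : A.ι) (k : C.ι) (x y) : Holds ((f ≫ g).entry i k).hom x y ↔
      ∃ j z, Holds (f.entry i j).hom x z ∧ Holds (g.entry j k).hom z y := by
  refine (holds_cpm_sum _ _ _ _).trans ?_
  simp only [Finset.mem_univ, true_and, holds_cpm_comp]

theorem pointHom_ne_zero (p : Σ i, El (A.X i).of) : pointHom p ≠ zeroMatrix A A := by
  intro h
  have h' : Holds ((pointHom p).entry p.1 p.1).hom (pr (cj p.2) p.2) (pr (cj p.2) p.2) :=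
    ⟨rfl, rfl, rfl, rfl⟩
  rw [h] at h'
  exact h'

theorem pointHom_comp {p q : Σ i, El (A.X i).of} (hpq : p ≠ q) :
    pointHom p ≫ pointHom q = zeroMatrix A A := by
  refine matrix_ext fun i k x y => ?_
  rw [holds_matrix_comp]
  constructor
  · rintro ⟨j, z, ⟨-, -, h, -⟩, ⟨h', -⟩⟩
    exact (hpq (h.symm.trans h')).elim
  · exact fun h => h.elim

theorem exists_holds_of_ne_zero {f : A ⟶ A} (hf : f ≠ zeroMatrix A A) :
    ∃ i j x y, Holds (f.entry i j).hom x y := by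
  by_contra! h
  exact hf (matrix_ext fun i j x y => ⟨fun hxy => h i j x y hxy, fun h => h.elim⟩)

/-- In `CPM[Rel]^⊕`, an endomorphism monoid without zero divisors has at most two elements. -/
theorem eq_of_endNoZeroDivisors {z f g : A ⟶ A} (h : EndNoZeroDivisors A z) (hf : f ≠ z)
    (hg : g ≠ z) : f = g := by
  -- A zero element of a monoid is unique: evaluate zero matrix followed by z in two ways.
  have hz : z = zeroMatrix A A := by
    rw [← (h.1 (zeroMatrix A A)).1]
    refine matrix_ext fun i k x y => ?_
    rw [holds_matrix_comp]
    exact ⟨fun ⟨_, _, h, _⟩ => h, fun h => h.elim⟩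
  subst hz
  -- Two distinct points anywhere in the family, in the same block or not, would give zero divisors.
  have hs : ∀ p q : Σ i, El (A.X i).of, p = q := by
    intro p q
    by_contra hpq
    exact (h.2 _ _ (pointHom_comp hpq)).elim (pointHom_ne_zero p) (pointHom_ne_zero q)
  have hs' : ∀ p q : Σ i, El (A.X i).of × El (A.X i).of, p = q := by
    rintro ⟨i, a, b⟩ ⟨j, c, d⟩
    cases hs ⟨i, a⟩ ⟨j, c⟩
    cases hs ⟨i, b⟩ ⟨i, d⟩
    rfl
  -- With at most one element in the whole disjoint union, a relation is either empty or full.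
  have key : ∀ f : A ⟶ A, f ≠ zeroMatrix A A → ∀ i j x y, Holds (f.entry i j).hom x y := by
    intro f hf i j x y
    obtain ⟨i', j', x', y', hh⟩ := exists_holds_of_ne_zero hf
    cases hs' ⟨i, x⟩ ⟨i', x'⟩
    cases hs' ⟨j, y⟩ ⟨j', y'⟩
    exact hh
  exact matrix_ext fun i j x y => iff_of_true (key f hf i j x y) (key g hg i j x y)

end Biproduct

/-! ### Three distinct endomorphisms, and the failure of equivalence -/

theorem fullHom_ne_emptyHom (Γ : Type u) [Group Γ] :
    CPStar.fullHom Γ ≠ CPStar.emptyHom _ _ := by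
  intro h
  have h' : Holds (CPStar.fullHom Γ).hom
      (⟨SingleObj.star Γ, SingleObj.star Γ, 𝟙 _⟩ : CPStar.Mor (SingleObj Γ))
      (⟨SingleObj.star Γ, SingleObj.star Γ, 𝟙 _⟩ : CPStar.Mor (SingleObj Γ)) := trivial
  rw [h] at h'
  exact h'

theorem id_ne_emptyHom (Γ : Type u) [Group Γ] :
    𝟙 (CPStar.ofGroupoid (SingleObj Γ)) ≠ CPStar.emptyHom _ _ := by
  intro h
  refine fullHom_ne_emptyHom Γ ?_
  rw [← Category.comp_id (CPStar.fullHom Γ), h, CPStar.comp_emptyHom]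

theorem fullHom_ne_id (Γ : Type u) [Group Γ] [Nontrivial Γ] :
    CPStar.fullHom Γ ≠ 𝟙 (CPStar.ofGroupoid (SingleObj Γ)) := by
  intro h
  obtain ⟨a, b, hab⟩ := exists_pair_ne Γ
  have h' : (⟨SingleObj.star Γ, SingleObj.star Γ, a⟩ : CPStar.Mor (SingleObj Γ)) =
      ⟨SingleObj.star Γ, SingleObj.star Γ, b⟩ :=
    (CPStar.holds_congr (congrArg CPStar.Hom.hom h) _ _).1 trivial
  exact hab (congrArg (fun p : CPStar.Mor (SingleObj Γ) => (p.2.2 : Γ)) h')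

/-- `CP*[Rel]` is not equivalent to the biproduct completion of `CPM[Rel]`: the endomorphisms of a
nontrivial group have no zero divisors, but there are at least three of them. -/
theorem isEmpty_equivalence :
    IsEmpty (BiprodCompletion (CPM RelCat.{u}) ≌ CPStar RelCat.{u}) := by
  refine ⟨fun E => ?_⟩
  let Γ : Type u := Multiplicative (ULift.{u} (ZMod 2))
  let F := E.inverse
  -- The images of the full relation and of the identity both differ from the image of the empty
  -- one, so they coincide, and faithfulness of F identifies the two endomorphisms of Γ.
  refine fullHom_ne_id Γ (F.map_injective (eq_of_endNoZeroDivisors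
    ((endNoZeroDivisors_group Γ).map F) ?_ ?_))
  · exact fun h => fullHom_ne_emptyHom Γ (F.map_injective h)
  · exact fun h => id_ne_emptyHom Γ (F.map_injective h)

theorem subsingleton_mor_sigma_codiscrete {ι : Type u} {X : ι → Type u}
    [Subsingleton (Σ i, Codiscrete (X i))] :
    Subsingleton (CPStar.Mor (Σ i, Codiscrete (X i))) := by
  have hom_eq : ∀ (x y : Σ i, Codiscrete (X i)) (f g : x ⟶ y), f = g := by
    rintro _ _ ⟨f⟩ ⟨g⟩
    rfl
  refine ⟨fun ⟨x, y, f⟩ ⟨x', y', f'⟩ => ?_⟩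
  obtain rfl := Subsingleton.elim x x'
  obtain rfl := Subsingleton.elim y y'
  rw [hom_eq x y f f']

end CQM

/-! ### The four claims -/

theorem mainTheorem7 :
    ¬ (CQM.canonicalFunctor.{u}).IsEquivalence ∧
    IsEmpty (CQM.BiprodCompletion (CQM.CPM RelCat.{u}) ≌ CQM.CPStar RelCat.{u}) ∧
    (∀ (H : Type u) [Groupoid.{u} H],
      Nonempty (CQM.CPStar.ofGroupoid (SingleObj (Multiplicative (ULift.{u} (ZMod 2)))) ≅
        CQM.CPStar.ofGroupoid H) →
      Nat.card H = 1 ∧ Nat.card (CQM.CPStar.Mor H) = 2) ∧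
    ∀ (ι : Type u) (X : ι → Type u),
      IsEmpty (CQM.CPStar.ofGroupoid (SingleObj (Multiplicative (ULift.{u} (ZMod 2)))) ≅
        CQM.CPStar.ofGroupoid (Σ i, Codiscrete (X i))) := by
  have hcard : Nat.card (Multiplicative (ULift.{u} (ZMod 2))) = 2 := by
    rw [Nat.card_congr Multiplicative.toAdd, Nat.card_congr Equiv.ulift, Nat.card_zmod]
  refine ⟨fun h => ?_, CQM.isEmpty_equivalence, fun H _ ⟨e⟩ => ?_, fun ι X => ⟨fun e => ?_⟩⟩
  · exact CQM.isEmpty_equivalence.false CQM.canonicalFunctor.asEquivalence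
  · rw [← hcard]
    exact CQM.CPStar.card_of_iso_group e
  -- One object in the disjoint union leaves at most one morphism, against the two elements of the
  -- group.
  · obtain ⟨h₁, h₂⟩ := CQM.CPStar.card_of_iso_group e
    rw [hcard] at h₂
    have := (Nat.card_eq_one_iff_unique.1 h₁).1
    have := CQM.subsingleton_mor_sigma_codiscrete (X := X)
    have := Finite.card_le_one_iff_subsingleton.2 this
    omega
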